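/- Let $\vartheta:\mathbb{R}^{n}\to\mathbb{R}\cup\{+\infty\}$ be closed (its epigraph is closed), proper and convex, with effective domain $D=\operatorname{dom}(\vartheta)=\{x:\vartheta(x)<+\infty\}$. Write $\operatorname{ri}(D)$ for the relative interior of $D$, $\operatorname{rbd}(D)=\overline{D}\setminus\operatorname{ri}(D)$ for its relative boundary, and $\operatorname{dom}(\partial\vartheta)$ for the set of points at which $\vartheta$ has at least one subgradient. Differentiability of $\vartheta$ on $\operatorname{ri}(D)$ and the gradient $\nabla\vartheta$ are understood relative to the affine hull of $D$ (so $\nabla\vartheta(x)$ lies in the direction space of the affine hull; this is the usual gradient if $D$ has nonempty interior). Call $\vartheta$ *steep* if $D$ is nonempty and convex, $\vartheta$ is differentiable on $\operatorname{ri}(D)$, and $\|\nabla\vartheta(x_k)\|\to+\infty$ for every sequence $(x_k)$ in $\operatorname{ri}(D)$ converging to a point of $\operatorname{rbd}(D)$. Call $\vartheta$ *non-steep* if $\vartheta$ is differentiable on $\operatorname{ri}(D)$ and $(\|\nabla\vartheta(x_k)\|)$ is bounded for every sequence $(x_k)$ in $\operatorname{ri}(D)$ converging to a point of $\operatorname{rbd}(D)$.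 Then the following hold. (i) If $\vartheta$ is steep, then $\operatorname{dom}(\partial\vartheta)=\operatorname{ri}(D)$, and $\operatorname{rbd}(D)\not\subseteq\operatorname{dom}(\partial\vartheta)$ whenever $\operatorname{rbd}(D)\neq\varnothing$. (ii) If $\vartheta$ is non-steep, then $\operatorname{rbd}(D)\subseteq\operatorname{dom}(\partial\vartheta)$ and $\operatorname{dom}(\partial\vartheta)=D$. -/

import Mathlib

namespace ConvexReg

open Filter Topology

/-- Effective domain of an extended-real-valued function. -/
def dom {n : ℕ} (f : EuclideanSpace ℝ (Fin n) → EReal) : Set (EuclideanSpace ℝ (Fin n)) :=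
  {x | f x < ⊤}

/-- Epigraph of an extended-real-valued function. -/
def epigraph {n : ℕ} (f : EuclideanSpace ℝ (Fin n) → EReal) :
    Set (EuclideanSpace ℝ (Fin n) × ℝ) :=
  {q | f q.1 ≤ (q.2 : EReal)}

/-- Proper: the value `-∞` is never attained and some value is less than `+∞`. -/
def IsProper {n : ℕ} (f : EuclideanSpace ℝ (Fin n) → EReal) : Prop :=
  (∀ x, f x ≠ ⊥) ∧ ∃ x, f x < ⊤

/-- Closed: the epigraph is closed. -/
def IsClosedFun {n : ℕ} (f : EuclideanSpace ℝ (Fin n) → EReal) : Prop :=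
  IsClosed (epigraph f)

/-- Convex: the epigraph is convex. -/
def IsConvexFun {n : ℕ} (f : EuclideanSpace ℝ (Fin n) → EReal) : Prop :=
  Convex ℝ (epigraph f)

/-- Relative interior. -/
def ri {n : ℕ} (C : Set (EuclideanSpace ℝ (Fin n))) : Set (EuclideanSpace ℝ (Fin n)) :=
  intrinsicInterior ℝ C

/-- Relative boundary: closure minus relative interior. -/
def rbd {n : ℕ} (C : Set (EuclideanSpace ℝ (Fin n))) : Set (EuclideanSpace ℝ (Fin n)) :=
  closure C \ ri C

/-- Subdifferential: all `v` with `f y ≥ f x + ⟨v, y - x⟩` for every `y`.  For proper `f` it is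
empty at points where `f x = +∞`. -/
def subdiff {n : ℕ} (f : EuclideanSpace ℝ (Fin n) → EReal) (x : EuclideanSpace ℝ (Fin n)) :
    Set (EuclideanSpace ℝ (Fin n)) :=
  {v | ∀ y, f x + ((inner ℝ v (y - x) : ℝ) : EReal) ≤ f y}

/-- Domain of the subdifferential. -/
def domSubdiff {n : ℕ} (f : EuclideanSpace ℝ (Fin n) → EReal) :
    Set (EuclideanSpace ℝ (Fin n)) :=
  {x | (subdiff f x).Nonempty}

/-- `g` is the gradient of `f` at `x` relative to the affine hull of `dom f`, meant for
`x ∈ ri (dom f)`: `g` lies in the direction space of the affine hull and is the gradient of `f`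
within `dom f`, which near such an `x` is all of the affine hull.  If `dom f` has nonempty
interior, this is the usual gradient. -/
def HasRelGradientAt {n : ℕ} (f : EuclideanSpace ℝ (Fin n) → EReal)
    (g x : EuclideanSpace ℝ (Fin n)) : Prop :=
  g ∈ (affineSpan ℝ (dom f)).direction ∧
    HasGradientWithinAt (fun y => (f y).toReal) g (dom f) x

/-- Differentiable on the relative interior of the domain. -/
def DifferentiableOnRi {n : ℕ} (f : EuclideanSpace ℝ (Fin n) → EReal) : Prop :=
  ∀ x ∈ ri (dom f), ∃ g, HasRelGradientAt f g x

/-- Steep (relatively essentially smooth): the gradient norms tend to `+∞` along every sequence in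
the relative interior of the domain that converges to a relative boundary point.  The sequence of
gradients is written `g`. -/
def IsSteep {n : ℕ} (f : EuclideanSpace ℝ (Fin n) → EReal) : Prop :=
  (dom f).Nonempty ∧ Convex ℝ (dom f) ∧ DifferentiableOnRi f ∧
    ∀ x g : ℕ → EuclideanSpace ℝ (Fin n),
      (∀ k, x k ∈ ri (dom f)) → (∀ k, HasRelGradientAt f (g k) (x k)) →
      ∀ a ∈ rbd (dom f), Tendsto x atTop (𝓝 a) → Tendsto (fun k => ‖g k‖) atTop atTop

/-- Non-steep: the gradient norms stay bounded along every sequence in the relative interior of the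
domain that converges to a relative boundary point. -/
def IsNonSteep {n : ℕ} (f : EuclideanSpace ℝ (Fin n) → EReal) : Prop :=
  DifferentiableOnRi f ∧
    ∀ x g : ℕ → EuclideanSpace ℝ (Fin n),
      (∀ k, x k ∈ ri (dom f)) → (∀ k, HasRelGradientAt f (g k) (x k)) →
      ∀ a ∈ rbd (dom f), Tendsto x atTop (𝓝 a) → ∃ M : ℝ, ∀ k, ‖g k‖ ≤ M

end ConvexReg

/-!
Consider the segment from a point `x` of the closure of the domain to a relative interior point
`z`: apart from `x` it lies in the relative interior.

* If `v` is a subgradient at `x` itself, then the subgradients `g` along the segment stay bounded: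
  apply the subgradient inequality of `g` at `a x + b (z + ε w)` and that of `v` at
  `a x + b z`; convexity then cancels the factor `b` and bounds `⟪g, w⟫` independently of `g` and
  `b`. So a steep function has no subgradient on the relative boundary.
* If the gradients along the segment are bounded, a cluster point of them is a subgradient at `x`,
  because the subdifferential of a closed function has closed graph.
-/

namespace ConvexReg

open Bornology Filter Topology

section RelativeInterior

variable {V : Type*} [NormedAddCommGroup V] [NormedSpace ℝ V] {s : Set V} {x y : V}

/-- The parametrization `w ↦ w + p` of the affine span of `s` by its direction space. It turns
relative topological notions for `s` into absolute ones for a subset of a normed space. -/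
noncomputable def spanChart (p : affineSpan ℝ s) : (affineSpan ℝ s).direction →ᵃ[ℝ] V :=
  haveI : Nonempty (affineSpan ℝ s) := ⟨p⟩
  (affineSpan ℝ s).subtype.comp (AffineEquiv.vaddConst ℝ p)

theorem spanChart_apply (p : affineSpan ℝ s) (w : (affineSpan ℝ s).direction) :
    spanChart p w = w + p :=
  rfl

theorem image_spanChart_interior_preimage (p : affineSpan ℝ s) :
    spanChart p '' interior (spanChart p ⁻¹' s) = intrinsicInterior ℝ s :=
  haveI : Nonempty (affineSpan ℝ s) := ⟨p⟩
  image_interior_preimage_comp _ (AffineIsometryEquiv.vaddConst ℝ p).toHomeomorph.isHomeomorph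
    Subtype.val s

theorem image_spanChart_closure_preimage (p : affineSpan ℝ s) :
    spanChart p '' closure (spanChart p ⁻¹' s) = intrinsicClosure ℝ s :=
  haveI : Nonempty (affineSpan ℝ s) := ⟨p⟩
  image_closure_preimage_comp _ (AffineIsometryEquiv.vaddConst ℝ p).toHomeomorph.isHomeomorph
    Subtype.val s

theorem openSegment_intrinsicClosure_intrinsicInterior_subset_intrinsicInterior (hs : Convex ℝ s)
    (hx : x ∈ intrinsicClosure ℝ s) (hy : y ∈ intrinsicInterior ℝ s) :
    openSegment ℝ x y ⊆ intrinsicInterior ℝ s := by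
  let p : affineSpan ℝ s := ⟨y, subset_affineSpan ℝ s (intrinsicInterior_subset hy)⟩
  rw [← image_spanChart_closure_preimage p] at hx
  rw [← image_spanChart_interior_preimage p] at hy ⊢
  obtain ⟨a, ha, hax⟩ := hx
  obtain ⟨b, hb, hby⟩ := hy
  rw [← hax, ← hby, ← image_openSegment]
  exact Set.image_mono
    ((hs.affine_preimage (spanChart p)).openSegment_closure_interior_subset_interior ha hb)

theorem exists_pos_add_smul_mem_of_mem_intrinsicInterior (hx : x ∈ intrinsicInterior ℝ s) {w : V}
    (hw : w ∈ (affineSpan ℝ s).direction) : ∃ ε : ℝ, 0 < ε ∧ x + ε • w ∈ s := by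
  let p : affineSpan ℝ s := ⟨x, subset_affineSpan ℝ s (intrinsicInterior_subset hx)⟩
  let d : (affineSpan ℝ s).direction := ⟨w, hw⟩
  rw [← image_spanChart_interior_preimage p] at hx
  obtain ⟨c, hc, hcx⟩ := hx
  have hc_zero : c = 0 := by simpa [spanChart_apply, p] using hcx
  rw [hc_zero] at hc
  have htend : Tendsto (fun ε : ℝ => ε • d) (𝓝[>] 0) (𝓝 0) := by
    have : Continuous fun ε : ℝ => ε • d := by fun_prop
    simpa using (this.tendsto 0).mono_left nhdsWithin_le_nhds
  have hnhds : ∀ᶠ ε : ℝ in 𝓝[>] 0, ε • d ∈ spanChart p ⁻¹' s :=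
    htend.eventually_mem (mem_interior_iff_mem_nhds.1 hc)
  obtain ⟨ε, hmem, hε⟩ := (hnhds.and self_mem_nhdsWithin).exists
  exact ⟨ε, hε, by simpa [spanChart_apply, p, d, add_comm] using hmem⟩

end RelativeInterior

section Subgradient

variable {E : Type*} [NormedAddCommGroup E] [InnerProductSpace ℝ E] {s : Set E} {F : E → ℝ}
  {g v x z : E}

/-- Bounds from above suffice for Banach-Steinhaus since `w` can be replaced by `-w`. -/
theorem isBounded_of_forall_bddAbove_inner {W : Submodule ℝ E} [CompleteSpace W] {G : Set E}
    (hGW : G ⊆ W) (hG : ∀ w ∈ W, BddAbove ((fun g => inner ℝ g w) '' G)) : IsBounded G := by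
  have hpointwise (w : W) : ∃ C, ∀ g : G, ‖innerSL ℝ (⟨g, hGW g.2⟩ : W) w‖ ≤ C := by
    obtain ⟨C₁, hC₁⟩ := hG w w.2
    obtain ⟨C₂, hC₂⟩ := hG (-w) (W.neg_mem w.2)
    refine ⟨max C₁ C₂, fun g => abs_le'.2 ⟨?_, ?_⟩⟩
    · exact (hC₁ ⟨g, g.2, rfl⟩).trans (le_max_left _ _)
    · simpa using (hC₂ ⟨g, g.2, rfl⟩).trans (le_max_right C₁ _)
  obtain ⟨M, hM⟩ := banach_steinhaus hpointwise
  refine isBounded_iff_forall_norm_le.2 ⟨M, fun g hg => ?_⟩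
  simpa [innerSL_apply_norm] using hM ⟨g, hg⟩

/-- `v` is a subgradient at `x` of the real-valued function `F` on `s`, that is, of the
extended-real-valued function equal to `F` on `s` and to `+∞` elsewhere. -/
def IsSubgradientOn (F : E → ℝ) (s : Set E) (v x : E) : Prop :=
  ∀ y ∈ s, F x + inner ℝ v (y - x) ≤ F y

theorem isSubgradientOn_of_hasGradientWithinAt [CompleteSpace E] (hF : ConvexOn ℝ s F)
    (hx : x ∈ s) (hg : HasGradientWithinAt F g s x) : IsSubgradientOn F s g x := by
  intro y hy
  let l : ℝ →ᵃ[ℝ] E := AffineMap.lineMap x y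
  have hl₀ : l 0 = x := AffineMap.lineMap_apply_zero x y
  have hl₁ : l 1 = y := AffineMap.lineMap_apply_one x y
  have hderiv : HasDerivWithinAt (F ∘ l) (inner ℝ g (y - x)) (l ⁻¹' s) 0 := by
    rw [← hl₀] at hg
    exact hg.hasFDerivWithinAt.comp_hasDerivWithinAt 0 AffineMap.hasDerivWithinAt_lineMap
      (Set.mapsTo_preimage l s)
  have hslope := (hF.comp_affineMap l).le_slope_of_hasDerivWithinAt (x := 0) (y := 1)
    (by rwa [Set.mem_preimage, hl₀]) (by rwa [Set.mem_preimage, hl₁]) one_pos hderiv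
  rw [slope_def_field, Function.comp_apply, Function.comp_apply, hl₀, hl₁] at hslope
  linarith

theorem isBounded_subgradients_openSegment [CompleteSpace (affineSpan ℝ s).direction]
    (hF : ConvexOn ℝ s F) (hx : x ∈ s) (hv : IsSubgradientOn F s v x)
    (hz : z ∈ intrinsicInterior ℝ s) :
    IsBounded {g | g ∈ (affineSpan ℝ s).direction ∧
      ∃ p ∈ openSegment ℝ x z, IsSubgradientOn F s g p} := by
  refine isBounded_of_forall_bddAbove_inner (fun g hg => hg.1) fun w hw => ?_
  obtain ⟨ε, hε, hzw⟩ := exists_pos_add_smul_mem_of_mem_intrinsicInterior hz hw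
  refine ⟨ε⁻¹ * (F (z + ε • w) - F x - inner ℝ v (z - x)), ?_⟩
  rintro _ ⟨g, ⟨-, p, ⟨a, b, ha, hb, hab, rfl⟩, hg⟩, rfl⟩
  have hv_le : F x + b * inner ℝ v (z - x) ≤ F (a • x + b • z) := by
    have hdiff : a • x + b • z - x = b • (z - x) := by
      rw [← eq_sub_iff_add_eq] at hab
      subst hab
      module
    simpa only [hdiff, inner_smul_right] using
      hv _ (hF.1 hx (intrinsicInterior_subset hz) ha.le hb.le hab)
  have hg_le : F (a • x + b • z) + b * (ε * inner ℝ g w) ≤ F (a • x + b • (z + ε • w)) := by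
    have hdiff : a • x + b • (z + ε • w) - (a • x + b • z) = b • ε • w := by module
    simpa only [hdiff, inner_smul_right] using hg _ (hF.1 hx hzw ha.le hb.le hab)
  have hF_le : F (a • x + b • (z + ε • w)) ≤ a * F x + b * F (z + ε • w) :=
    hF.2 hx hzw ha.le hb.le hab
  rw [le_inv_mul_iff₀ hε]
  refine le_of_mul_le_mul_left ?_ hb
  linear_combination hv_le + hg_le + hF_le + F x * hab

end Subgradient

variable {n : ℕ} {f : EuclideanSpace ℝ (Fin n) → EReal} {x v g a z : EuclideanSpace ℝ (Fin n)}

theorem IsProper.coe_toReal (hf : IsProper f) (hx : x ∈ dom f) : ((f x).toReal : EReal) = f x :=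
  EReal.coe_toReal (ne_of_lt hx) (hf.1 x)

theorem IsProper.mem_epigraph_iff (hf : IsProper f) (hx : x ∈ dom f) {r : ℝ} :
    (x, r) ∈ epigraph f ↔ (f x).toReal ≤ r := by
  rw [← EReal.coe_le_coe_iff, hf.coe_toReal hx]
  rfl

theorem mem_dom_of_mem_epigraph {r : ℝ} (h : (x, r) ∈ epigraph f) : x ∈ dom f :=
  lt_of_le_of_lt h (EReal.coe_lt_top r)

theorem IsConvexFun.convexOn_toReal (hc : IsConvexFun f) (hf : IsProper f) :
    ConvexOn ℝ (dom f) fun y => (f y).toReal := by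
  have hcombo {x y : EuclideanSpace ℝ (Fin n)} (hx : x ∈ dom f) (hy : y ∈ dom f) {a b : ℝ}
      (ha : 0 ≤ a) (hb : 0 ≤ b) (hab : a + b = 1) :
      (a • x + b • y, a • (f x).toReal + b • (f y).toReal) ∈ epigraph f :=
    hc ((hf.mem_epigraph_iff hx).2 le_rfl) ((hf.mem_epigraph_iff hy).2 le_rfl) ha hb hab
  have hconv : Convex ℝ (dom f) := fun _ hx _ hy _ _ ha hb hab =>
    mem_dom_of_mem_epigraph (hcombo hx hy ha hb hab)
  exact ⟨hconv, fun _ hx _ hy _ _ ha hb hab =>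
    (hf.mem_epigraph_iff (hconv hx hy ha hb hab)).1 (hcombo hx hy ha hb hab)⟩

theorem IsProper.mem_subdiff_iff_epigraph (hf : IsProper f) :
    v ∈ subdiff f x ↔ ∀ y ∈ dom f, (x, (f y).toReal - inner ℝ v (y - x)) ∈ epigraph f := by
  refine forall_congr' fun y => ?_
  by_cases hy : y ∈ dom f
  · simp only [hy, forall_const, epigraph, Set.mem_ofPred_eq, EReal.coe_sub, hf.coe_toReal hy]
    exact (EReal.le_sub_iff_add_le (.inl (EReal.coe_ne_bot _)) (.inl (EReal.coe_ne_top _))).symm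
  · simp only [hy, false_imp_iff, iff_true]
    exact le_top.trans_eq (not_lt_top_iff.1 hy).symm

theorem IsProper.domSubdiff_subset_dom (hf : IsProper f) : domSubdiff f ⊆ dom f := by
  rintro x ⟨v, hv⟩
  obtain ⟨y, hy⟩ := hf.2
  exact mem_dom_of_mem_epigraph (hf.mem_subdiff_iff_epigraph.1 hv y hy)

theorem IsProper.mem_subdiff_iff_isSubgradientOn (hf : IsProper f) (hx : x ∈ dom f) :
    v ∈ subdiff f x ↔ IsSubgradientOn (fun y => (f y).toReal) (dom f) v x := by
  simp only [hf.mem_subdiff_iff_epigraph, hf.mem_epigraph_iff hx, le_sub_iff_add_le,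
    IsSubgradientOn]

theorem IsClosedFun.isClosed_graph_subdiff (hcl : IsClosedFun f) (hf : IsProper f) :
    IsClosed {q : EuclideanSpace ℝ (Fin n) × EuclideanSpace ℝ (Fin n) | q.2 ∈ subdiff f q.1} := by
  simp only [hf.mem_subdiff_iff_epigraph, Set.ofPred_forall]
  exact isClosed_biInter fun y _ => hcl.preimage (by fun_prop :
    Continuous fun q : EuclideanSpace ℝ (Fin n) × EuclideanSpace ℝ (Fin n) =>
      (q.1, (f y).toReal - inner ℝ q.2 (y - q.1)))

theorem HasRelGradientAt.isSubgradientOn (hg : HasRelGradientAt f g x) (hf : IsProper f)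
    (hc : IsConvexFun f) (hx : x ∈ dom f) :
    IsSubgradientOn (fun y => (f y).toReal) (dom f) g x :=
  isSubgradientOn_of_hasGradientWithinAt (hc.convexOn_toReal hf) hx hg.2

theorem HasRelGradientAt.mem_subdiff (hg : HasRelGradientAt f g x) (hf : IsProper f)
    (hc : IsConvexFun f) (hx : x ∈ dom f) : g ∈ subdiff f x :=
  (hf.mem_subdiff_iff_isSubgradientOn hx).2 (hg.isSubgradientOn hf hc hx)

theorem DifferentiableOnRi.ri_subset_domSubdiff (hd : DifferentiableOnRi f) (hf : IsProper f)
    (hc : IsConvexFun f) : ri (dom f) ⊆ domSubdiff f := fun x hx =>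
  let ⟨g, hg⟩ := hd x hx
  ⟨g, hg.mem_subdiff hf hc (intrinsicInterior_subset hx)⟩

theorem DifferentiableOnRi.exists_seq_hasRelGradientAt_tendsto (hd : DifferentiableOnRi f)
    (hconv : Convex ℝ (dom f)) (ha : a ∈ closure (dom f)) (hz : z ∈ ri (dom f)) :
    ∃ u g : ℕ → EuclideanSpace ℝ (Fin n), (∀ k, u k ∈ openSegment ℝ a z) ∧
      (∀ k, u k ∈ ri (dom f)) ∧ (∀ k, HasRelGradientAt f (g k) (u k)) ∧
      Tendsto u atTop (𝓝 a) := by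
  obtain ⟨u, huseg, hua⟩ := mem_closure_iff_seq_limit.1
    (segment_subset_closure_openSegment (left_mem_segment ℝ a z))
  rw [← intrinsicClosure_eq_closure ℝ] at ha
  have huri k : u k ∈ ri (dom f) :=
    openSegment_intrinsicClosure_intrinsicInterior_subset_intrinsicInterior hconv ha hz (huseg k)
  choose g hg using fun k => hd (u k) (huri k)
  exact ⟨u, g, huseg, huri, hg, hua⟩

theorem IsSteep.domSubdiff_subset_ri (hs : IsSteep f) (hf : IsProper f) (hc : IsConvexFun f) :
    domSubdiff f ⊆ ri (dom f) := by
  intro x hxsub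
  by_contra hxri
  have hx : x ∈ dom f := hf.domSubdiff_subset_dom hxsub
  obtain ⟨v, hv⟩ := hxsub
  obtain ⟨hne, hconv, hd, hsteep⟩ := hs
  obtain ⟨z, hz⟩ := hne.intrinsicInterior hconv
  obtain ⟨u, g, huseg, huri, hg, hux⟩ :=
    hd.exists_seq_hasRelGradientAt_tendsto hconv (subset_closure hx) hz
  have hsubgrad k := (hg k).isSubgradientOn hf hc (intrinsicInterior_subset (huri k))
  obtain ⟨M, hM⟩ := (isBounded_subgradients_openSegment (hc.convexOn_toReal hf) hx
    ((hf.mem_subdiff_iff_isSubgradientOn hx).1 hv) hz).exists_norm_le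
  have hunbounded := hsteep u g huri hg x ⟨subset_closure hx, hxri⟩ hux
  obtain ⟨k, hk⟩ := (hunbounded.eventually_gt_atTop M).exists
  exact hk.not_ge (hM (g k) ⟨(hg k).1, u k, huseg k, hsubgrad k⟩)

theorem IsSteep.domSubdiff_eq_ri (hs : IsSteep f) (hf : IsProper f) (hc : IsConvexFun f) :
    domSubdiff f = ri (dom f) :=
  (hs.domSubdiff_subset_ri hf hc).antisymm (hs.2.2.1.ri_subset_domSubdiff hf hc)

theorem IsNonSteep.rbd_subset_domSubdiff (hs : IsNonSteep f) (hcl : IsClosedFun f)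
    (hf : IsProper f) (hc : IsConvexFun f) : rbd (dom f) ⊆ domSubdiff f := by
  intro a ha
  have hconv : Convex ℝ (dom f) := (hc.convexOn_toReal hf).1
  obtain ⟨z, hz⟩ := Set.Nonempty.intrinsicInterior hconv hf.2
  obtain ⟨u, g, -, huri, hg, hua⟩ := hs.1.exists_seq_hasRelGradientAt_tendsto hconv ha.1 hz
  have hsubdiff k : g k ∈ subdiff f (u k) :=
    (hg k).mem_subdiff hf hc (intrinsicInterior_subset (huri k))
  obtain ⟨M, hM⟩ := hs.2 u g huri hg a ha hua
  obtain ⟨g₀, -, φ, hφ, hg₀⟩ := tendsto_subseq_of_bounded Metric.isBounded_closedBall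
    fun k => mem_closedBall_zero_iff.2 (hM k)
  exact ⟨g₀, (hcl.isClosed_graph_subdiff hf).mem_of_tendsto
    ((hua.comp hφ.tendsto_atTop).prodMk_nhds hg₀) (.of_forall fun k => hsubdiff (φ k))⟩

theorem IsNonSteep.domSubdiff_eq_dom (hs : IsNonSteep f) (hcl : IsClosedFun f) (hf : IsProper f)
    (hc : IsConvexFun f) : domSubdiff f = dom f := by
  refine hf.domSubdiff_subset_dom.antisymm fun x hx => ?_
  by_cases hxri : x ∈ ri (dom f)
  · exact hs.1.ri_subset_domSubdiff hf hc hxri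
  · exact hs.rbd_subset_domSubdiff hcl hf hc ⟨subset_closure hx, hxri⟩

end ConvexReg

theorem mainTheorem7 {n : ℕ} (f : EuclideanSpace ℝ (Fin n) → EReal)
    (hclosed : ConvexReg.IsClosedFun f) (hproper : ConvexReg.IsProper f)
    (hconvex : ConvexReg.IsConvexFun f) :
    (ConvexReg.IsSteep f →
      ((ConvexReg.rbd (ConvexReg.dom f)).Nonempty →
        ¬ ConvexReg.rbd (ConvexReg.dom f) ⊆ ConvexReg.domSubdiff f) ∧
      ConvexReg.domSubdiff f = ConvexReg.ri (ConvexReg.dom f)) ∧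
    (ConvexReg.IsNonSteep f →
      ConvexReg.rbd (ConvexReg.dom f) ⊆ ConvexReg.domSubdiff f ∧
      ConvexReg.domSubdiff f = ConvexReg.dom f) := by
  refine ⟨fun hsteep => ?_, fun hnonsteep =>
    ⟨hnonsteep.rbd_subset_domSubdiff hclosed hproper hconvex,
      hnonsteep.domSubdiff_eq_dom hclosed hproper hconvex⟩⟩
  have hdom := hsteep.domSubdiff_eq_ri hproper hconvex
  refine ⟨fun ⟨a, ha⟩ hsub => ?_, hdom⟩
  have ha_ri : a ∈ ConvexReg.ri (ConvexReg.dom f) := hdom ▸ hsub ha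
  exact ha.2 ha_ri
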